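/- **Setting.** A CSS code on $n$ data qubits is given by parity-check matrices $H_X,H_Z$ over $\mathbb F_2$ with $H_XH_Z^{\mathsf T}=0$; their rows are the $X$- and $Z$-checks. Let $L_X$ (resp. $L_Z$) be a matrix whose rows represent a basis of $\ker H_Z$ modulo $\operatorname{span}(H_X)$ (resp. of $\ker H_X$ modulo $\operatorname{span}(H_Z)$), where $\operatorname{span}$ denotes the row span. *Circuits.* A single-ancilla, CNOT-based syndrome extraction circuit (SEC) $\mathcal C$ assigns to each check a dedicated ancilla and the time steps of its preparation, of one CNOT with each data qubit in the support of the check, and of its measurement. The ancilla of an $X$ ($Z$) check is prepared in $|+\rangle$ ($|0\rangle$), is the control (target) of its CNOTs and is measured in the $X$ ($Z$) basis; a qubit takes part in at most one operation at a time, and the noiseless circuit measures all checks. The circuit is repeated for several rounds, each being a time shift of the same circuit; rounds may be staggered, but an ancilla is measured before it is prepared again. $\mathcal C$ is *non-interleaved* if, in each round, either all CNOTs of $X$-checks precede all CNOTs of $Z$-checks on the same data qubit, or all CNOTs of $Z$-checks precede all CNOTs of $X$-checks on the same data qubit. *Circuit distance.* In the $M$-round $B$-basis memory experiment ($B\in\{X,Z\}$,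 $M\ge1$), data qubits are prepared in the basis $B$, $M$ rounds are performed, and the data qubits are measured in the basis $B$. The error mechanisms are: a preparation of a data or ancilla qubit yields the orthogonal state; a measurement outcome of a data or ancilla qubit is flipped; a CNOT is followed by a non-identity two-qubit Pauli operator; an idle operation is followed by a non-identity Pauli operator. The detectors compare the outcomes of a check in consecutive rounds and, for the checks of type $B$, also compare the first outcome with its value in the prepared state and the last outcome with its value reconstructed from the final data measurements; the logical observables are the rows of $L_B$. The circuit distance $d_{\mathrm{circ}}$ of $\mathcal C$ is the minimum over both bases $B$ of the minimum number of error mechanisms that together flip no detector but at least one logical observable. *Residual errors.* For a check with support $i_1,\dots,i_w$ listed in CNOT order, the residual errors are $E_l=\sum_{s=l}^{w}e_{i_s}\in\mathbb F_2^n$, $l=2,\dots,w$; they are of the type ($X$ or $Z$) of the check. Let $\mathcal E=\mathcal E_X\sqcup\mathcal E_Z$ be the disjoint union of the sets of residual errors of all $X$- and all $Z$-checks. For a $Z$-type residual error $E$, the residual distance is $$\Delta(E)=1+\min\{|D| : D\in\mathbb F_2^n,\ E+D\in\ker H_X\setminus\operatorname{span}(H_Z)\},$$ where $|\cdot|$ is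 the Hamming weight. For $\mathcal R_Z\subseteq\mathcal E_Z$, append to each of $H_X$ and $L_X$, for every $E\in\mathcal R_Z$, the column that is the sum of its columns in the support of $E$; $d^Z_{\mathrm{ext}}(\mathcal R_Z)$ is the minimum Hamming weight of a vector $x$ with $H_X^{\mathrm{ext}}x=0$ and $L_X^{\mathrm{ext}}x\ne0$. The $X$-type notions are obtained by exchanging $X$ and $Z$, and $d_{\mathrm{ext}}(\mathcal R_X\sqcup\mathcal R_Z)=\min\bigl(d^X_{\mathrm{ext}}(\mathcal R_X),d^Z_{\mathrm{ext}}(\mathcal R_Z)\bigr)$. Minima over empty sets are $\infty$. **Theorem (Circuit distance bounds).** Let $\mathcal C$ be any single-ancilla, CNOT-based SEC for a CSS code, and let $\mathcal C'$ be a non-interleaved SEC for the same code that has the same relative CNOT order within each check. Then $\mathcal C$ and $\mathcal C'$ have the same set $\mathcal E$ of residual errors, and their circuit distances $d_{\mathrm{circ}}$ and $d'_{\mathrm{circ}}$, for any numbers $M,M'\ge1$ of rounds respectively, satisfy $$d'_{\mathrm{circ}}\le\Delta(E)\quad\forall E\in\mathcal E,\qquad d'_{\mathrm{circ}}\le d_{\mathrm{ext}}(\mathcal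 R)\quad\forall\mathcal R\subseteq\mathcal E,\qquad d'_{\mathrm{circ}}=d_{\mathrm{ext}}(\mathcal E),\qquad d'_{\mathrm{circ}}\le d_{\mathrm{circ}}.$$ -/

import Mathlib

/-! Syndrome extraction circuits for CSS codes, circuit-level noise, residual errors and the
associated distances. All distances take values in `ℕ∞`, and the minimum over an empty set is `⊤`. -/

namespace CSSCircuit

/-- The two CSS types: types of checks, of Pauli components, and of single-qubit bases. -/
inductive PauliType where
  | X : PauliType
  | Z : PauliType
  deriving DecidableEq

instance : Fintype PauliType where
  elems := {.X, .Z}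
  complete := by intro b; cases b <;> simp

/-- Exchange of `X` and `Z`. -/
def PauliType.swap : PauliType → PauliType
  | .X => .Z
  | .Z => .X

/-- A CSS code on `n` data qubits, given by parity-check matrices `H X`, `H Z` over `𝔽₂`
(whose rows are the chosen checks) with `H_X H_Zᵀ = 0`. -/
structure CSSCode (n : ℕ) where
  /-- number of checks of each type -/
  m : PauliType → ℕ
  /-- parity-check matrices -/
  H : (b : PauliType) → Matrix (Fin (m b)) (Fin n) (ZMod 2)
  comm : H .X * (H .Z).transpose = 0

variable {n : ℕ}

namespace CSSCode

/-- The `b`-type stabilisers: the row span of `H_b`. -/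
def stab (K : CSSCode n) (b : PauliType) : Submodule (ZMod 2) (Fin n → ZMod 2) :=
  Submodule.span (ZMod 2) (Set.range (K.H b))

/-- The `b`-type operators commuting with all checks of the other type: `ker H_{b.swap}`. -/
def normalizer (K : CSSCode n) (b : PauliType) : Submodule (ZMod 2) (Fin n → ZMod 2) :=
  LinearMap.ker (K.H b.swap).mulVecLin

/-- A check: its type together with a row index of the corresponding matrix. -/
abbrev Check (K : CSSCode n) : Type := Σ b : PauliType, Fin (K.m b)

/-- The data qubits in the support of a check. -/
def supp (K : CSSCode n) (c : K.Check) : Finset (Fin n) :=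
  Finset.univ.filter fun q => K.H c.1 c.2 q = 1

/-- The qubits: data qubits, and one dedicated ancilla for each check. -/
abbrev Qubit (K : CSSCode n) : Type := Fin n ⊕ K.Check

end CSSCode

/-- Logical operator matrices `L X`, `L Z`: for each type `b`, the rows of `L b` represent a basis
of the `b`-type logical operators `ker H_{b.swap}` modulo the `b`-type stabilisers. -/
structure LogicalBasis (K : CSSCode n) where
  /-- number of logical qubits -/
  k : ℕ
  /-- logical operator matrices -/
  L : PauliType → Matrix (Fin k) (Fin n) (ZMod 2)
  span_eq : ∀ b, K.stab b ⊔ Submodule.span (ZMod 2) (Set.range (L b)) = K.normalizer b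
  indep : ∀ b, LinearIndependent (ZMod 2) fun i : Fin k => (K.stab b).mkQ (L b i)

/-- A single-ancilla, CNOT-based syndrome extraction circuit. It is specified by the time steps, for
each check, of the ancilla preparation, of the CNOTs with the data qubits in its support, and of the
ancilla measurement. The circuit is repeated for rounds `0, 1, 2, …`; the operations of
round `r` are shifted by `start r`, and successive rounds may be staggered (may overlap in time).

The ancilla of an `X` (`Z`) check is prepared in `|+⟩` (`|0⟩`), is the control (target) of its CNOTs
and is measured in the `X` (`Z`) basis. -/
structure SEC (K : CSSCode n) where
  /-- time step of the ancilla preparation -/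
  prep : K.Check → ℕ
  /-- time step of the CNOT between the ancilla and a data qubit in the support of the check -/
  cnot : K.Check → Fin n → ℕ
  /-- time step of the ancilla measurement -/
  meas : K.Check → ℕ
  /-- time shift of each round -/
  start : ℕ → ℕ
  prep_lt_meas : ∀ c, prep c < meas c
  prep_lt_cnot : ∀ c, ∀ q ∈ K.supp c, prep c < cnot c q
  cnot_lt_meas : ∀ c, ∀ q ∈ K.supp c, cnot c q < meas c
  /-- the ancilla is measured before it is prepared again in the next round -/
  reuse : ∀ r c, start r + meas c < start (r + 1) + prep c
  /-- an ancilla participates in at most one CNOT at a time -/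
  cnot_inj : ∀ c, Set.InjOn (cnot c) (K.supp c)
  /-- a data qubit participates in at most one CNOT at a time -/
  no_clash : ∀ r s c c' q, q ∈ K.supp c → q ∈ K.supp c' →
    start r + cnot c q = start s + cnot c' q → c = c'
  /-- The noiseless circuit measures the checks. Pulling the operator measured on an `X` ancilla back
  through the circuit gives the `X` check on the data qubits, times an `X` on every `Z` ancilla whose
  CNOTs precede those of the `X` check on an odd number of the shared data qubits; there must be no
  such `Z` ancilla, as it is prepared in `|0⟩`. The condition for measurements of `Z` ancillas is
  the same one, since the supports of an `X` and a `Z` check share an even number of qubits. -/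
  valid : ∀ (r s : ℕ) (x : Fin (K.m .X)) (z : Fin (K.m .Z)),
    Even ((K.supp ⟨.X, x⟩ ∩ K.supp ⟨.Z, z⟩).filter fun q =>
      start s + cnot ⟨.Z, z⟩ q < start r + cnot ⟨.X, x⟩ q).card

/-- A single-qubit Pauli operator up to phase, by its `X` and `Z` components (`Y` has both). -/
abbrev Pauli : Type := PauliType → ZMod 2

/-- A Pauli operator on all the qubits, up to phase. -/
abbrev Frame (K : CSSCode n) : Type := K.Qubit → Pauli

/-- Error mechanisms of circuit noise. In `cnot r c q P Q` the Pauli `P` acts on the ancilla and `Q`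
on the data qubit. -/
inductive Fault (K : CSSCode n) where
  /-- the preparation of a data qubit yields the orthogonal state -/
  | prepData (q : Fin n) : Fault K
  /-- the final measurement of a data qubit has its outcome flipped -/
  | measData (q : Fin n) : Fault K
  /-- the preparation of an ancilla in round `r` yields the orthogonal state -/
  | prepAnc (r : ℕ) (c : K.Check) : Fault K
  /-- the measurement of an ancilla in round `r` has its outcome flipped -/
  | measAnc (r : ℕ) (c : K.Check) : Fault K
  /-- the CNOT of the check `c` with the data qubit `q` in round `r` is followed by `P ⊗ Q` -/
  | cnot (r : ℕ) (c : K.Check) (q : Fin n) (P Q : Pauli) : Fault K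
  /-- the idle operation on the qubit `v` at time `t` is followed by `P` -/
  | idle (t : ℕ) (v : K.Qubit) (P : Pauli) : Fault K

namespace SEC

variable {K : CSSCode n}

/-- In `M` rounds, the CNOT between the ancilla of `c` and the data qubit `q` is applied at `t`. -/
def CNOTAt (C : SEC K) (M t : ℕ) (c : K.Check) (q : Fin n) : Prop :=
  q ∈ K.supp c ∧ ∃ r ∈ Finset.range M, t = C.start r + C.cnot c q

/-- In `M` rounds, the ancilla of `c` is prepared at time `t`. -/
def PrepAt (C : SEC K) (M t : ℕ) (c : K.Check) : Prop :=
  ∃ r ∈ Finset.range M, t = C.start r + C.prep c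

/-- In `M` rounds, the ancilla of `c` is measured at time `t`. -/
def MeasAt (C : SEC K) (M t : ℕ) (c : K.Check) : Prop :=
  ∃ r ∈ Finset.range M, t = C.start r + C.meas c

instance (C : SEC K) (M t : ℕ) (c : K.Check) (q : Fin n) : Decidable (C.CNOTAt M t c q) := by
  unfold CNOTAt; infer_instance

instance (C : SEC K) (M t : ℕ) (c : K.Check) : Decidable (C.PrepAt M t c) := by
  unfold PrepAt; infer_instance

instance (C : SEC K) (M t : ℕ) (c : K.Check) : Decidable (C.MeasAt M t c) := by
  unfold MeasAt; infer_instance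

/-- The qubit `v` idles at time `t`. -/
def IdleAt (C : SEC K) (M t : ℕ) : K.Qubit → Prop
  | .inl q => ∀ c, ¬ C.CNOTAt M t c q
  | .inr c => ¬ C.PrepAt M t c ∧ ¬ C.MeasAt M t c ∧ ∀ q, ¬ C.CNOTAt M t c q

/-- The number of time steps of `M` rounds. -/
def duration (C : SEC K) (M : ℕ) : ℕ :=
  (Finset.range M ×ˢ (Finset.univ : Finset K.Check)).sup fun p => C.start p.1 + C.meas p.2 + 1

/-- The error mechanisms that are present in the `M`-round memory experiment. -/
def IsFault (C : SEC K) (M : ℕ) : Fault K → Prop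
  | .prepData _ => True
  | .measData _ => True
  | .prepAnc r _ => r < M
  | .measAnc r _ => r < M
  | .cnot r c q P Q => r < M ∧ q ∈ K.supp c ∧ (P, Q) ≠ 0
  | .idle t v P => t < C.duration M ∧ C.IdleAt M t v ∧ P ≠ 0

/-- Propagation of a Pauli error through the operations of time step `t`. A CNOT adds the `X`
component of its control to its target, and the `Z` component of its target to its control. As the
ancilla is the control for `X` checks and the target for `Z` checks, the CNOTs of a check of type `b`
add the `b` component of the ancilla to the data qubit, and the other component of the data qubit to
the ancilla. A preparation resets the ancilla. (Each sum has at most one term, because a qubit is in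
at most one CNOT at a time.) -/
def propagate (C : SEC K) (M t : ℕ) (F : Frame K) : Frame K
  | .inl q => fun b => F (.inl q) b +
      ∑ c : K.Check, if C.CNOTAt M t c q ∧ c.1 = b then F (.inr c) b else 0
  | .inr c => if C.PrepAt M t c then 0 else fun b => F (.inr c) b +
      ∑ q : Fin n, if C.CNOTAt M t c q ∧ c.1 ≠ b then F (.inl q) b else 0

/-- The Pauli error that an error mechanism inserts right after the operations of time step `t`.
A preparation in the basis `b` is flipped by a Pauli operator of the other type. -/
def inject (C : SEC K) (t : ℕ) : Fault K → Frame K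
  | .prepAnc r c => if t = C.start r + C.prep c then
      Pi.single (.inr c) (Pi.single c.1.swap 1) else 0
  | .cnot r c q P Q => if t = C.start r + C.cnot c q then
      Pi.single (.inr c) P + Pi.single (.inl q) Q else 0
  | .idle s v P => if t = s then Pi.single v P else 0
  | _ => 0

/-- The Pauli error that an error mechanism inserts right after the data qubits have been prepared
in the basis `B`. -/
def injectInit (B : PauliType) : Fault K → Frame K
  | .prepData q => Pi.single (.inl q) (Pi.single B.swap 1)
  | _ => 0

/-- The Pauli error just before time step `t` in the `M`-round `B`-basis memory experiment with error
configuration `e`. The data qubits are prepared in the basis `B` before time step `0`. -/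
def frame (C : SEC K) (B : PauliType) (M : ℕ) (e : Finset (Fault K)) : ℕ → Frame K
  | 0 => ∑ f ∈ e, injectInit B f
  | t + 1 => C.propagate M t (C.frame B M e t) + ∑ f ∈ e, C.inject t f

/-- Whether (`1`) or not (`0`) a fault flips the classical outcome of ancilla `c` in round `r`. -/
def ancReadout (r : ℕ) (c : K.Check) : Fault K → ZMod 2
  | .measAnc r' c' => if r' = r ∧ c' = c then 1 else 0
  | _ => 0

/-- Whether (`1`) or not (`0`) a fault flips the classical outcome of the data qubit `q`. -/
def dataReadout (q : Fin n) : Fault K → ZMod 2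
  | .measData q' => if q' = q then 1 else 0
  | _ => 0

/-- The flip of the outcome of check `c` in round `r`: a measurement in the basis `b` is
flipped by the component of the other type. -/
def ancFlip (C : SEC K) (B : PauliType) (M : ℕ) (e : Finset (Fault K)) (r : ℕ) (c : K.Check) :
    ZMod 2 :=
  C.frame B M e (C.start r + C.meas c) (.inr c) c.1.swap + ∑ f ∈ e, ancReadout r c f

/-- The flips of the outcomes of the final measurement of the data qubits in the basis `B`. -/
def dataFlip (C : SEC K) (B : PauliType) (M : ℕ) (e : Finset (Fault K)) : Fin n → ZMod 2 :=
  fun q => C.frame B M e (C.duration M) (.inl q) B.swap + ∑ f ∈ e, dataReadout q f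

/-- The error configuration flips no detector of the `M`-round `B`-basis memory experiment. The
detectors compare the outcomes of a check in consecutive rounds; for checks of type `B`, moreover,
the first outcome is compared with its value in the prepared state, and the last outcome with the
value reconstructed from the final measurement of the data qubits. -/
def Undetected (C : SEC K) (B : PauliType) (M : ℕ) (e : Finset (Fault K)) : Prop :=
  (∀ c : K.Check, ∀ r, r + 1 < M → C.ancFlip B M e r c + C.ancFlip B M e (r + 1) c = 0) ∧
  (∀ i : Fin (K.m B), C.ancFlip B M e 0 ⟨B, i⟩ = 0) ∧
  (∀ i : Fin (K.m B),
    C.ancFlip B M e (M - 1) ⟨B, i⟩ + ((K.H B).mulVec (C.dataFlip B M e)) i = 0)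

/-- The minimum number of error mechanisms in the `M`-round (`M ≥ 1`) `B`-basis memory experiment
that flip no detector but flip at least one logical observable. -/
noncomputable def memoryDistance (C : SEC K) (L : LogicalBasis K) (B : PauliType) (M : ℕ) : ℕ∞ :=
  ⨅ e ∈ {e : Finset (Fault K) | (∀ f ∈ e, C.IsFault M f) ∧ C.Undetected B M e ∧
    (L.L B).mulVec (C.dataFlip B M e) ≠ 0}, (e.card : ℕ∞)

/-- The circuit distance, for `M`-round memory experiments. -/
noncomputable def circuitDistance (C : SEC K) (L : LogicalBasis K) (M : ℕ) : ℕ∞ :=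
  min (C.memoryDistance L .X M) (C.memoryDistance L .Z M)

/-- Within each round, all CNOTs of one type precede all CNOTs of the other type that
act on the same data qubit. -/
def NonInterleaved (C : SEC K) : Prop :=
  ∃ b : PauliType, ∀ (i : Fin (K.m b)) (j : Fin (K.m b.swap)),
    ∀ q ∈ K.supp ⟨b, i⟩ ∩ K.supp ⟨b.swap, j⟩, C.cnot ⟨b, i⟩ q < C.cnot ⟨b.swap, j⟩ q

/-- The two circuits have the same relative CNOT order within each check. -/
def SameOrder (C C' : SEC K) : Prop :=
  ∀ c, ∀ q ∈ K.supp c, ∀ q' ∈ K.supp c, C.cnot c q < C.cnot c q' ↔ C'.cnot c q < C'.cnot c q'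

/-- The vector `∑_{s ≥ l} e_{i_s}`, where `i_1, …, i_w` is the support of the check `c` in the CNOT
order and `q = i_l`. -/
def tail (C : SEC K) (c : K.Check) (q : Fin n) : Fin n → ZMod 2 :=
  fun q' => if q' ∈ K.supp c ∧ C.cnot c q ≤ C.cnot c q' then 1 else 0

/-- The complete set of residual errors `∑_{s ≥ l} e_{i_s}`, `2 ≤ l ≤ w`, of all checks, as a disjoint
union: each residual error is paired with its check. A residual error of a `b`-type check is
a `b`-type error. -/
def residualErrors (C : SEC K) : Finset (K.Check × (Fin n → ZMod 2)) :=
  ((Finset.univ : Finset (K.Check × Fin n)).filter fun p =>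
    p.2 ∈ K.supp p.1 ∧ ∃ q ∈ K.supp p.1, C.cnot p.1 q < C.cnot p.1 p.2).image
      fun p => (p.1, C.tail p.1 p.2)

end SEC

/-- The residual distance `Δ(E)`: one plus the minimum weight of a `D` such that `E + D` is a
non-trivial logical operator of the type `b` of `E`, i.e. lies in `ker H_{b.swap} ∖ span H_b`. -/
noncomputable def residualDistance (K : CSSCode n) (E : K.Check × (Fin n → ZMod 2)) : ℕ∞ :=
  1 + ⨅ D ∈ {D : Fin n → ZMod 2 | E.2 + D ∈ K.normalizer E.1.1 ∧ E.2 + D ∉ K.stab E.1.1},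
    (hammingNorm D : ℕ∞)

/-- Extension of a matrix by one column for each residual error in `R`: the sum of the columns of the
data qubits in that residual error. -/
def extend {K : CSSCode n} {a : ℕ} (A : Matrix (Fin a) (Fin n) (ZMod 2))
    (R : Finset (K.Check × (Fin n → ZMod 2))) : Matrix (Fin a) (Fin n ⊕ R) (ZMod 2) :=
  Matrix.fromCols A (Matrix.of fun i E => A.mulVec E.1.2 i)

/-- The `b`-type extended-code distance of a set of `b`-type residual errors: the minimum weight of
an `x` with `H^ext x = 0` and `L^ext x ≠ 0`, for the matrices `H`, `L` of the other type. -/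
noncomputable def typeExtDistance {K : CSSCode n} (L : LogicalBasis K) (b : PauliType)
    (R : Finset (K.Check × (Fin n → ZMod 2))) : ℕ∞ :=
  ⨅ x ∈ {x : Fin n ⊕ R → ZMod 2 |
    (extend (K.H b.swap) R).mulVec x = 0 ∧ (extend (L.L b.swap) R).mulVec x ≠ 0},
    (hammingNorm x : ℕ∞)

/-- The combined extended-code distance of a set of residual errors, which is split into its residual
errors of the two types. -/
noncomputable def extDistance {K : CSSCode n} (L : LogicalBasis K)
    (R : Finset (K.Check × (Fin n → ZMod 2))) : ℕ∞ :=
  min (typeExtDistance L .X (R.filter fun E => E.1.1 = .X))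
    (typeExtDistance L .Z (R.filter fun E => E.1.1 = .Z))

end CSSCircuit

namespace CSSCircuit

variable {n : ℕ} {K : CSSCode n}

/-! In the `B`-basis experiment only Pauli components of type `B.swap` flip the final data
measurements, and propagation is linear over `𝔽₂`, so the total data flip is the sum of the
contributions of the single faults (`dataFlip_eq_sum`). An ancilla error of the type of its check
spreads to exactly the data qubits whose CNOTs are still to come in that round, hence to a tail of
the check. A proper tail is a residual error; the full tail is the check itself, a stabiliser. So in
any circuit each fault amounts, modulo stabilisers, to at most one column of the extended matrices
(`isColumn_fault`). Undetected faults leave zero syndrome on the final data, so an undetected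
logical error gives a vector of the extended code whose weight is at most the number of faults
(`typeExtDistance_le_memoryDistance`).

Conversely, in a non-interleaved circuit each column is produced by one fault: a data error by a
faulty data preparation or readout, a residual error by a CNOT fault acting on both qubits. If the
CNOTs of type `B.swap` come first, preparation faults and round `0` are used, and every check of
type `B` sees the whole error, whose syndrome is zero. Otherwise readout faults and the last round
are used, and these checks see none of it. Checks of type `B.swap` are blind to such errors. Hence
no detector fires (`memoryDistance_le_typeExtDistance`).

The distance of `C'` is therefore the extended distance of all residual errors, which depends only
on the CNOT order within the checks and bounds the distance of `C` from below. Deleting columns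
cannot lower an extended distance, and a residual error together with a data error `D` has weight at
most `1 + |D|`; this gives the remaining two bounds. -/

lemma PauliType.swap_swap (b : PauliType) : b.swap.swap = b := by cases b <;> rfl

lemma PauliType.swap_ne (b : PauliType) : b.swap ≠ b := by cases b <;> decide

lemma PauliType.ne_swap_iff {a b : PauliType} : a ≠ b.swap ↔ a = b := by
  cases a <;> cases b <;> decide

lemma zmod_two_eq (x : ZMod 2) : x = 0 ∨ x = 1 := by revert x; decide

/-! ### Rounds of an ancilla, and propagation of errors to the data -/

namespace SEC

variable (C : SEC K)

lemma start_meas_lt_start_prep {r s : ℕ} (h : r < s) (c : K.Check) :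
    C.start r + C.meas c < C.start s + C.prep c := by
  induction s, h using Nat.le_induction with
  | base => exact C.reuse r c
  | succ s _ ih =>
    have := C.reuse s c
    have := C.prep_lt_meas c
    omega

lemma start_mono_of_check (c : K.Check) {r s : ℕ} (h : r ≤ s) : C.start r ≤ C.start s := by
  rcases h.eq_or_lt with rfl | h
  · rfl
  · have := C.start_meas_lt_start_prep h c
    have := C.prep_lt_meas c
    omega

lemma round_unique {r s t : ℕ} {c : K.Check} (hr : C.start r + C.prep c ≤ t)
    (hr' : t ≤ C.start r + C.meas c) (hs : C.start s + C.prep c ≤ t)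
    (hs' : t ≤ C.start s + C.meas c) : r = s := by
  rcases lt_trichotomy r s with h | h | h
  · have := C.start_meas_lt_start_prep h c
    omega
  · exact h
  · have := C.start_meas_lt_start_prep h c
    omega

/-- An error on the ancilla of `c` present just before time step `t` spreads to the data qubit `q`
before time step `T`. -/
def Reaches (M T t : ℕ) (c : K.Check) (q : Fin n) : Prop :=
  q ∈ K.supp c ∧ ∃ r ∈ Finset.range M, C.start r + C.prep c < t ∧
    t ≤ C.start r + C.cnot c q ∧ C.start r + C.cnot c q < T

instance (M T t : ℕ) (c : K.Check) (q : Fin n) : Decidable (C.Reaches M T t c q) := by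
  unfold Reaches; infer_instance

/-- Lifetimes of an ancilla in different rounds are disjoint, so the round in `Reaches` is forced to
be `r`. The shift to `t + 1` is there because faults act right after step `t`. -/
lemma reaches_iff_of_mem_round {M T t r : ℕ} {c : K.Check} {q : Fin n} (hr : r < M)
    (hp : C.start r + C.prep c ≤ t) (ht : t ≤ C.start r + C.meas c) :
    C.Reaches M T (t + 1) c q ↔
      q ∈ K.supp c ∧ t < C.start r + C.cnot c q ∧ C.start r + C.cnot c q < T := by
  constructor
  · rintro ⟨hq, s, -, h1, h2, h3⟩
    have := C.cnot_lt_meas c q hq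
    obtain rfl := C.round_unique hp ht (s := s) (by omega) (by omega)
    exact ⟨hq, by omega, h3⟩
  · rintro ⟨hq, h1, h2⟩
    exact ⟨hq, r, by simpa using hr, by omega, by omega, h2⟩

lemma cnotAt_iff_of_mem_round {M t r : ℕ} {c : K.Check} {q : Fin n} (hr : r < M)
    (hp : C.start r + C.prep c ≤ t) (ht : t ≤ C.start r + C.meas c) :
    C.CNOTAt M t c q ↔ q ∈ K.supp c ∧ t = C.start r + C.cnot c q := by
  constructor
  · rintro ⟨hq, s, -, rfl⟩
    have := C.cnot_lt_meas c q hq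
    have := C.prep_lt_cnot c q hq
    obtain rfl := C.round_unique hp ht (s := s) (by omega) (by omega)
    exact ⟨hq, rfl⟩
  · rintro ⟨hq, h⟩
    exact ⟨hq, r, by simpa using hr, h⟩

lemma not_prepAt_of_mem_round {M t r : ℕ} {c : K.Check}
    (hp : C.start r + C.prep c < t) (ht : t ≤ C.start r + C.meas c) : ¬ C.PrepAt M t c := by
  rintro ⟨s, -, h⟩
  have := C.prep_lt_meas c
  obtain rfl := C.round_unique hp.le ht (s := s) (by omega) (by omega)
  omega

/-- The `b`-component of the data error just before time step `T` that is caused by the Pauli error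
`F` just before time step `t`. -/
def effective (b : PauliType) (M T t : ℕ) : Frame K →+ (Fin n → ZMod 2) where
  toFun F q := F (.inl q) b +
    ∑ c : K.Check, if c.1 = b ∧ C.Reaches M T t c q then F (.inr c) b else 0
  map_zero' := by ext q; simp
  map_add' F G := by
    ext q
    simp only [Pi.add_apply, ite_add_zero, Finset.sum_add_distrib]
    ring

lemma effective_apply (b : PauliType) (M T t : ℕ) (F : Frame K) (q : Fin n) :
    C.effective b M T t F q = F (.inl q) b +
      ∑ c : K.Check, if c.1 = b ∧ C.Reaches M T t c q then F (.inr c) b else 0 := rfl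

lemma effective_of_forall_not_reaches (b : PauliType) {M T t : ℕ} (F : Frame K) (q : Fin n)
    (h : ∀ c, ¬ C.Reaches M T t c q) : C.effective b M T t F q = F (.inl q) b := by
  simp [effective_apply, h]

/-- Conservation law behind the fault-by-fault analysis. The `b` component of a type-`b` ancilla
changes only by a reset, and a CNOT of its check merely moves a pending term from the ancilla sum to
the data term. -/
lemma effective_propagate (b : PauliType) {M T t : ℕ} (ht : t < T) (F : Frame K) :
    C.effective b M T (t + 1) (C.propagate M t F) = C.effective b M T t F := by
  ext q
  simp only [effective_apply, propagate, add_assoc, ← Finset.sum_add_distrib]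
  congr 1
  refine Finset.sum_congr rfl fun c _ => ?_
  by_cases hb : c.1 = b
  swap
  · simp [hb]
  by_cases h0 : C.Reaches M T t c q
  · obtain ⟨hq, r, hr, h1, h2, h3⟩ := id h0
    have hm := C.cnot_lt_meas c q hq
    rw [Finset.mem_range] at hr
    have hP := C.not_prepAt_of_mem_round (M := M) h1 (by omega)
    have hN := C.cnotAt_iff_of_mem_round (q := q) hr h1.le (by omega)
    have hR := C.reaches_iff_of_mem_round (T := T) (q := q) hr h1.le (by omega)
    by_cases hc : t = C.start r + C.cnot c q
    · have : ¬ t < C.start r + C.cnot c q := by omega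
      simp [hb, hN, hR, hq, h0, ← hc]
    · have : t < C.start r + C.cnot c q := by omega
      simp [hb, hP, hN, hR, hq, h0, hc, this, h3]
  · have hN : ¬ C.CNOTAt M t c q := by
      rintro ⟨hq, r, hr, rfl⟩
      have := C.prep_lt_cnot c q hq
      exact h0 ⟨hq, r, hr, by omega, le_rfl, ht⟩
    -- A round that opens at `t` may make `Reaches` true at `t + 1`, but the preparation has then
    -- erased the ancilla error.
    by_cases hP : C.PrepAt M t c
    · simp [hN, hP, h0]
    · have hR : ¬ C.Reaches M T (t + 1) c q := by
        rintro ⟨hq, r, hr, h1, h2, h3⟩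
        refine h0 ⟨hq, r, hr, ?_, by omega, h3⟩
        by_contra h
        exact hP ⟨r, hr, by omega⟩
      simp [hN, h0, hR]

/-- The `b`-component of the data error just before time step `T` that is caused by a fault in the
`B`-basis memory experiment. -/
def spread (b B : PauliType) (M T : ℕ) (f : Fault K) : Fin n → ZMod 2 :=
  (fun q => injectInit B f (.inl q) b) +
    ∑ s ∈ Finset.range T, C.effective b M T (s + 1) (C.inject s f)

/-- With `T` fixed, the effective error at `T` changes over time only by what the faults insert. At
both ends it is the plain data error: at time `0` no ancilla has been prepared, and at time `T` no
CNOT before `T` remains. -/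
lemma frame_data_eq_sum_spread (b B : PauliType) (M T : ℕ) (e : Finset (Fault K)) (q : Fin n) :
    C.frame B M e T (.inl q) b = ∑ f ∈ e, C.spread b B M T f q := by
  have key : ∀ t ≤ T, C.effective b M T t (C.frame B M e t) =
      ∑ f ∈ e, ((fun q => injectInit B f (.inl q) b) +
        ∑ s ∈ Finset.range t, C.effective b M T (s + 1) (C.inject s f)) := by
    intro t
    induction t with
    | zero =>
      intro _
      ext q
      rw [effective_of_forall_not_reaches]
      · simp [frame, Finset.sum_apply]
      · rintro c ⟨-, r, -, h, -⟩
        omega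
    | succ t ih =>
      intro h
      rw [frame, map_add, effective_propagate _ _ (by omega), ih (by omega), map_sum,
        ← Finset.sum_add_distrib]
      simp [Finset.sum_range_succ, add_assoc]
  have h := congrFun (key T le_rfl) q
  rw [effective_of_forall_not_reaches] at h
  · rw [h, Finset.sum_apply]
    rfl
  · rintro c ⟨-, r, -, -, h1, h2⟩
    omega

/-! ### The data error caused by a single fault -/

lemma effective_single_inl (b : PauliType) (M T t : ℕ) (q : Fin n) (P : Pauli) :
    C.effective b M T t (Pi.single (.inl q) P) = Pi.single q (P b) := by
  ext q'
  by_cases h : q' = q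
  · subst h; simp [effective_apply]
  · simp [effective_apply, h]

lemma effective_single_inr (b : PauliType) (M T t : ℕ) (c : K.Check) (P : Pauli) (q : Fin n) :
    C.effective b M T t (Pi.single (.inr c) P) q =
      if c.1 = b ∧ C.Reaches M T t c q then P b else 0 := by
  rw [effective_apply, Finset.sum_eq_single c]
  · simp
  · intro c' _ h
    have : (Sum.inr c' : K.Qubit) ≠ Sum.inr c := fun h' => h (Sum.inr.inj h')
    simp [Pi.single_eq_of_ne this]
  · simp

lemma start_meas_lt_duration {r M : ℕ} (h : r < M) (c : K.Check) :
    C.start r + C.meas c < C.duration M :=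
  Finset.le_sup (f := fun p : ℕ × K.Check => C.start p.1 + C.meas p.2 + 1)
    (b := (r, c)) (by simpa using h)

lemma spread_prepData (b B : PauliType) (M T : ℕ) (q : Fin n) :
    C.spread b B M T (.prepData q) = Pi.single q ((Pi.single B.swap 1 : Pauli) b) := by
  ext q'
  by_cases h : q' = q
  · subst h; simp [spread, injectInit, inject]
  · simp [spread, injectInit, inject, h]

lemma spread_measData (b B : PauliType) (M T : ℕ) (q : Fin n) :
    C.spread b B M T (.measData q) = 0 := by
  ext q'; simp [spread, injectInit, inject]

lemma spread_measAnc (b B : PauliType) (M T r : ℕ) (c : K.Check) :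
    C.spread b B M T (.measAnc r c) = 0 := by
  ext q'; simp [spread, injectInit, inject]

/-- A preparation flip has the type opposite to the check, and that component does not pass from the
ancilla to the data. -/
lemma spread_prepAnc (b B : PauliType) (M T r : ℕ) (c : K.Check) :
    C.spread b B M T (.prepAnc r c) = 0 := by
  ext q
  have h : ∀ s, C.effective b M T (s + 1) (C.inject s (.prepAnc r c)) = 0 := by
    intro s
    ext q
    rw [inject]
    split_ifs
    · rw [effective_single_inr]
      rcases eq_or_ne c.1 b with rfl | hb
      · simp [Pi.single_eq_of_ne (PauliType.swap_ne c.1).symm]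
      · simp [hb]
    · simp
  simp [spread, injectInit, h]

lemma spread_cnot (b B : PauliType) {M T r : ℕ} (c : K.Check) (q : Fin n) (P Q : Pauli)
    (hT : C.start r + C.cnot c q < T) :
    C.spread b B M T (.cnot r c q P Q) =
      C.effective b M T (C.start r + C.cnot c q + 1) (Pi.single (.inr c) P) +
        Pi.single q (Q b) := by
  have h : ∀ s ∈ Finset.range T, s ≠ C.start r + C.cnot c q →
      C.effective b M T (s + 1) (C.inject s (.cnot r c q P Q)) = 0 := by
    intro s _ hs
    simp [inject, hs]
  rw [spread, Finset.sum_eq_single_of_mem _ (by simpa using hT) h]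
  ext q'
  simp [injectInit, inject, effective_single_inl]

lemma spread_cnot_of_le (b B : PauliType) {M T r : ℕ} (c : K.Check) (q : Fin n) (P Q : Pauli)
    (hT : T ≤ C.start r + C.cnot c q) : C.spread b B M T (.cnot r c q P Q) = 0 := by
  ext q'
  have h : ∀ s ∈ Finset.range T,
      C.effective b M T (s + 1) (C.inject s (.cnot r c q P Q)) = 0 := by
    intro s hs
    have : s ≠ C.start r + C.cnot c q := by rw [Finset.mem_range] at hs; omega
    simp [inject, this]
  rw [spread, Finset.sum_eq_zero h]
  simp [injectInit]

lemma spread_idle (b B : PauliType) {M T t : ℕ} (v : K.Qubit) (P : Pauli) (hT : t < T) :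
    C.spread b B M T (.idle t v P) = C.effective b M T (t + 1) (Pi.single v P) := by
  have h : ∀ s ∈ Finset.range T, s ≠ t →
      C.effective b M T (s + 1) (C.inject s (.idle t v P)) = 0 := by
    intro s _ hs
    simp [inject, hs]
  rw [spread, Finset.sum_eq_single_of_mem _ (by simpa using hT) h]
  ext q'
  simp [injectInit, inject]

/-- A CNOT fault that acts on both qubits with the type of the check spreads to the tail of the
check. -/
lemma spread_cnot_same (B : PauliType) {M r : ℕ} (T : ℕ) {c : K.Check} {q : Fin n} {P Q : Pauli}
    (hr : r < M) (hq : q ∈ K.supp c) (hP : P c.1 = 1) (hQ : Q c.1 = 1) (q' : Fin n) :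
    C.spread c.1 B M T (.cnot r c q P Q) q' =
      if C.start r + C.cnot c q' < T then C.tail c q q' else 0 := by
  rcases le_or_gt T (C.start r + C.cnot c q) with hT | hT
  · rw [spread_cnot_of_le _ _ _ _ _ _ _ hT]
    have : C.start r + C.cnot c q' < T → C.tail c q q' = 0 := by
      intro h
      exact if_neg fun h' => by omega
    split_ifs with h
    · exact (this h).symm
    · rfl
  · have h1 := C.prep_lt_cnot c q hq
    have h2 := C.cnot_lt_meas c q hq
    rw [spread_cnot _ _ _ _ _ _ _ hT, Pi.add_apply, effective_single_inr, hP, hQ]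
    simp only [C.reaches_iff_of_mem_round (T := T) (q := q') hr
      (Nat.add_le_add_left h1.le _) (Nat.add_le_add_left h2.le _), true_and]
    -- The entry at `q` comes from `Q`; the ancilla part covers only strictly later CNOTs. Together
    -- they give the `≤` of `tail`.
    rcases eq_or_ne q' q with rfl | hne
    · simp [tail, hq, hT]
    · by_cases hs : q' ∈ K.supp c
      · have : C.cnot c q ≠ C.cnot c q' := fun h => hne (C.cnot_inj c hs hq h.symm)
        simp only [hs, true_and, tail, Pi.single_eq_of_ne hne, add_zero]
        grind
      · simp [tail, hs, hne]

end SEC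

/-! ### Orthogonality of stabilisers and logical operators -/

lemma CSSCode.H_swap_mul_transpose (K : CSSCode n) (b : PauliType) :
    K.H b.swap * (K.H b).transpose = 0 := by
  cases b
  · have := congrArg Matrix.transpose K.comm
    rwa [Matrix.transpose_mul, Matrix.transpose_transpose, Matrix.transpose_zero] at this
  · exact K.comm

lemma CSSCode.dotProduct_eq_zero_of_mem_stab {b : PauliType} {v w : Fin n → ZMod 2}
    (hv : v ∈ K.stab b) (hw : (K.H b).mulVec w = 0) : w ⬝ᵥ v = 0 := by
  induction hv using Submodule.span_induction with
  | mem x hx =>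
    obtain ⟨i, rfl⟩ := hx
    rw [dotProduct_comm]
    exact congrFun hw i
  | zero => simp
  | add x y _ _ hx hy => simp [dotProduct_add, hx, hy]
  | smul a x _ hx => simp [dotProduct_smul, hx]

lemma CSSCode.mulVec_eq_zero_of_mem_stab {b : PauliType} {v : Fin n → ZMod 2}
    (hv : v ∈ K.stab b) : (K.H b.swap).mulVec v = 0 := by
  ext i
  refine K.dotProduct_eq_zero_of_mem_stab hv ?_
  ext j
  have h := congrFun (congrFun (K.H_swap_mul_transpose b) i) j
  rw [Matrix.mul_apply'] at h
  simpa [Matrix.mulVec, dotProduct_comm] using h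

lemma LogicalBasis.H_mulVec_row (L : LogicalBasis K) (b : PauliType) (i : Fin L.k) :
    (K.H b).mulVec (L.L b.swap i) = 0 := by
  have h : L.L b.swap i ∈ K.normalizer b.swap := by
    rw [← L.span_eq]
    exact Submodule.mem_sup_right (Submodule.subset_span ⟨i, rfl⟩)
  rwa [CSSCode.normalizer, PauliType.swap_swap, LinearMap.mem_ker] at h

lemma LogicalBasis.mulVec_eq_zero_of_mem_stab (L : LogicalBasis K) {b : PauliType}
    {v : Fin n → ZMod 2} (hv : v ∈ K.stab b) : (L.L b.swap).mulVec v = 0 := by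
  ext i
  exact K.dotProduct_eq_zero_of_mem_stab hv (L.H_mulVec_row b i)

/-- An operator that commutes with all checks and all logical operators is a stabiliser. -/
lemma LogicalBasis.mem_stab_of_mulVec_eq_zero (L : LogicalBasis K) {b : PauliType}
    {v : Fin n → ZMod 2} (hH : (K.H b.swap).mulVec v = 0) (hL : (L.L b.swap).mulVec v = 0) :
    v ∈ K.stab b := by
  by_contra hv
  -- A functional separating `v` from the stabilisers is pairing with a vector `w`. It commutes with
  -- the checks of type `b`, so it is a combination of checks and logical operators of type
  -- `b.swap`, all orthogonal to `v`: a contradiction.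
  obtain ⟨f, hf, hle⟩ := Submodule.exists_le_ker_of_notMem hv
  have hfw : ∀ u, f u = (fun i => f (Pi.single i 1)) ⬝ᵥ u := by
    intro u
    conv_lhs => rw [pi_eq_sum_univ' u]
    simp [dotProduct, mul_comm]
  set w : Fin n → ZMod 2 := fun i => f (Pi.single i 1) with hw
  have hker : w ∈ K.normalizer b.swap := by
    rw [CSSCode.normalizer, PauliType.swap_swap, LinearMap.mem_ker]
    ext i
    rw [Matrix.mulVecLin_apply, Matrix.mulVec, dotProduct_comm, ← hfw]
    exact hle (Submodule.subset_span ⟨i, rfl⟩)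
  rw [← L.span_eq, CSSCode.stab, ← Submodule.span_union] at hker
  refine hf ?_
  rw [hfw, dotProduct_comm]
  clear_value w
  clear hfw hw
  induction hker using Submodule.span_induction with
  | mem x hx =>
    rcases hx with ⟨i, rfl⟩ | ⟨i, rfl⟩
    · rw [dotProduct_comm]; exact congrFun hH i
    · rw [dotProduct_comm]; exact congrFun hL i
  | zero => simp
  | add x y _ _ hx hy => simp [dotProduct_add, hx, hy]
  | smul a x _ hx => simp [dotProduct_smul, hx]

/-! ### Extended matrices and their columns -/

/-- The data error of a vector indexed by the columns of an extended matrix. -/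
def collapse (R : Finset (K.Check × (Fin n → ZMod 2))) :
    (Fin n ⊕ R → ZMod 2) →ₗ[ZMod 2] (Fin n → ZMod 2) where
  toFun x := (fun q => x (.inl q)) + ∑ E : R, x (.inr E) • E.1.2
  map_add' x y := by
    simp only [Pi.add_apply, add_smul, Finset.sum_add_distrib]
    ext q
    simp only [Pi.add_apply]
    ring
  map_smul' a x := by
    simp only [Pi.smul_apply, smul_add, Finset.smul_sum, smul_smul, smul_eq_mul, RingHom.id_apply]
    rfl

lemma collapse_apply (R : Finset (K.Check × (Fin n → ZMod 2))) (x : Fin n ⊕ R → ZMod 2) :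
    collapse R x = (fun q => x (.inl q)) + ∑ E : R, x (.inr E) • E.1.2 := rfl

lemma extend_mulVec {a : ℕ} (A : Matrix (Fin a) (Fin n) (ZMod 2))
    (R : Finset (K.Check × (Fin n → ZMod 2))) (x : Fin n ⊕ R → ZMod 2) :
    (extend A R).mulVec x = A.mulVec (collapse R x) := by
  rw [extend, Matrix.fromCols_mulVec, collapse_apply, Matrix.mulVec_add, Matrix.mulVec_sum]
  congr 1
  ext i
  simp only [Matrix.mulVec_smul, Finset.sum_apply, Pi.smul_apply, smul_eq_mul]
  rw [Matrix.mulVec, dotProduct]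
  exact Finset.sum_congr rfl fun E _ => mul_comm _ _

lemma collapse_single_inl (R : Finset (K.Check × (Fin n → ZMod 2))) (q : Fin n) (a : ZMod 2) :
    collapse R (Pi.single (.inl q) a) = Pi.single q a := by
  ext q'
  by_cases h : q' = q
  · subst h; simp [collapse_apply]
  · simp [collapse_apply, h]

lemma collapse_single_inr (R : Finset (K.Check × (Fin n → ZMod 2))) (E : R) :
    collapse R (Pi.single (.inr E) 1) = E.1.2 := by
  ext q
  rw [collapse_apply, Finset.sum_eq_single E]
  · simp
  · intro E' _ h
    have : (Sum.inr E' : Fin n ⊕ R) ≠ Sum.inr E := fun h' => h (Sum.inr.inj h')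
    simp [Pi.single_eq_of_ne this]
  · simp

lemma sum_map_support {ι κ V : Type*} [Fintype ι] [AddCommGroup V] [Module (ZMod 2) V]
    (φ : ι ↪ κ) (x : ι → ZMod 2) (g : κ → V) :
    ∑ f ∈ (Finset.univ.filter fun i => x i ≠ 0).map φ, g f = ∑ i, x i • g (φ i) := by
  rw [Finset.sum_map, Finset.sum_filter]
  refine Finset.sum_congr rfl fun i _ => ?_
  rcases zmod_two_eq (x i) with h | h <;> simp [h]

lemma collapse_eq_sum (R : Finset (K.Check × (Fin n → ZMod 2))) (x : Fin n ⊕ R → ZMod 2) :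
    collapse R x = ∑ i, x i • collapse R (Pi.single i 1) := by
  conv_lhs => rw [pi_eq_sum_univ' x]
  rw [map_sum]
  refine Finset.sum_congr rfl fun i _ => ?_
  rw [map_smul]

lemma hammingNorm_single_le {ι : Type*} [Fintype ι] [DecidableEq ι] (i : ι) (a : ZMod 2) :
    hammingNorm (Pi.single i a : ι → ZMod 2) ≤ 1 := by
  rw [hammingNorm]
  refine (Finset.card_le_card (t := {i}) fun j hj => ?_).trans (by simp)
  by_contra h
  simp at h
  simp [h] at hj

lemma hammingNorm_add_le {ι : Type*} [Fintype ι] (x y : ι → ZMod 2) :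
    hammingNorm (x + y) ≤ hammingNorm x + hammingNorm y := by
  classical
  rw [hammingNorm, hammingNorm, hammingNorm]
  refine (Finset.card_le_card fun i hi => ?_).trans (Finset.card_union_le _ _)
  simp only [Finset.mem_filter, Finset.mem_univ, true_and, Finset.mem_union, Pi.add_apply] at hi ⊢
  by_contra! h
  simp [h] at hi

lemma hammingNorm_sum_le {ι κ : Type*} [Fintype ι] (s : Finset κ) (x : κ → ι → ZMod 2)
    (h : ∀ k ∈ s, hammingNorm (x k) ≤ 1) : hammingNorm (∑ k ∈ s, x k) ≤ s.card := by
  classical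
  induction s using Finset.induction_on with
  | empty => simp
  | insert k s hk ih =>
    rw [Finset.sum_insert hk, Finset.card_insert_of_notMem hk]
    have h1 := hammingNorm_add_le (x k) (∑ k ∈ s, x k)
    have h2 := h k (by simp)
    have h3 := ih fun j hj => h j (by simp [hj])
    omega

/-- Up to stabilisers, `v` is zero, a single-qubit error, or a residual error in `R`. -/
def IsColumn (b : PauliType) (R : Finset (K.Check × (Fin n → ZMod 2))) (v : Fin n → ZMod 2) :
    Prop :=
  ∃ x, hammingNorm x ≤ 1 ∧ collapse R x - v ∈ K.stab b

lemma isColumn_of_mem_stab {b : PauliType} (R : Finset (K.Check × (Fin n → ZMod 2)))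
    {v : Fin n → ZMod 2} (hv : v ∈ K.stab b) : IsColumn b R v :=
  ⟨0, by simp, by simpa using hv⟩

lemma isColumn_zero (b : PauliType) (R : Finset (K.Check × (Fin n → ZMod 2))) :
    IsColumn b R 0 :=
  isColumn_of_mem_stab R (zero_mem _)

lemma isColumn_single (b : PauliType) (R : Finset (K.Check × (Fin n → ZMod 2))) (q : Fin n)
    (a : ZMod 2) : IsColumn b R (Pi.single q a) :=
  ⟨Pi.single (.inl q) a, hammingNorm_single_le _ _, by simp [collapse_single_inl]⟩

lemma isColumn_of_mem {b : PauliType} {R : Finset (K.Check × (Fin n → ZMod 2))}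
    {E : K.Check × (Fin n → ZMod 2)} (h : E ∈ R) : IsColumn b R E.2 :=
  ⟨Pi.single (.inr ⟨E, h⟩) 1, hammingNorm_single_le _ _, by simp [collapse_single_inr]⟩

/-! ### Lower bound: each fault is at most one column -/

namespace SEC

variable (C : SEC K)

/-- The residual errors of type `b`. -/
abbrev typeResidualErrors (b : PauliType) : Finset (K.Check × (Fin n → ZMod 2)) :=
  C.residualErrors.filter fun E => E.1.1 = b

/-- A tail that starts after the first CNOT is a residual error; the tail from the first CNOT is a
row of `H`, a stabiliser. -/
lemma isColumn_tail {c : K.Check} {q : Fin n} (hq : q ∈ K.supp c) :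
    IsColumn c.1 (C.typeResidualErrors c.1) (C.tail c q) := by
  by_cases h : ∃ q' ∈ K.supp c, C.cnot c q' < C.cnot c q
  · refine isColumn_of_mem (E := (c, C.tail c q)) ?_
    simp only [typeResidualErrors, Finset.mem_filter, and_true]
    exact Finset.mem_image_of_mem (fun p : K.Check × Fin n => (p.1, C.tail p.1 p.2))
      (a := (c, q)) (by simpa using ⟨hq, h⟩)
  · push Not at h
    apply isColumn_of_mem_stab
    have : C.tail c q = K.H c.1 c.2 := by
      ext q'
      have hs : q' ∈ K.supp c ↔ K.H c.1 c.2 q' = 1 := by simp [CSSCode.supp]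
      rcases zmod_two_eq (K.H c.1 c.2 q') with h0 | h1
      · simp [tail, hs, h0]
      · have := h q' (hs.2 h1)
        simp [tail, hs, h1, this]
    rw [this]
    exact Submodule.subset_span ⟨c.2, rfl⟩

lemma isColumn_effective_inr (b : PauliType) (M t : ℕ) (c : K.Check) (P : Pauli) :
    IsColumn b (C.typeResidualErrors b)
      (C.effective b M (C.duration M) (t + 1) (Pi.single (.inr c) P)) := by
  rcases eq_or_ne c.1 b with rfl | hb
  swap
  · convert isColumn_zero b _
    ext q
    simp [effective_single_inr, hb]
  rcases zmod_two_eq (P c.1) with hP | hP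
  · convert isColumn_zero c.1 _
    ext q
    simp [effective_single_inr, hP]
  by_cases h : ∃ q, C.Reaches M (C.duration M) (t + 1) c q
  swap
  · push Not at h
    convert isColumn_zero c.1 _
    ext q
    simp [effective_single_inr, h]
  obtain ⟨q, hq, r, hr, h1, h2, h3⟩ := h
  rw [Finset.mem_range] at hr
  have hm := C.cnot_lt_meas c q hq
  -- The first qubit `p` that the ancilla meets after `t` is where the tail starts.
  obtain ⟨p, hp, hmin⟩ := Finset.exists_min_image
    ((K.supp c).filter fun p => t < C.start r + C.cnot c p) (C.cnot c)
    ⟨q, by simpa using ⟨hq, h2⟩⟩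
  simp only [Finset.mem_filter] at hp hmin
  convert C.isColumn_tail hp.1
  ext q'
  have hd := C.start_meas_lt_duration hr c
  rw [effective_single_inr, tail, hP]
  refine if_congr ?_ rfl rfl
  rw [C.reaches_iff_of_mem_round hr (by omega) (by omega)]
  constructor
  · rintro ⟨-, h4, h5, -⟩
    exact ⟨h4, hmin q' ⟨h4, h5⟩⟩
  · rintro ⟨h4, h5⟩
    have := C.cnot_lt_meas c q' h4
    exact ⟨rfl, h4, by omega, by omega⟩

lemma isColumn_fault (B : PauliType) {M : ℕ} {f : Fault K} (hf : C.IsFault M f) :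
    IsColumn B.swap (C.typeResidualErrors B.swap)
      (C.spread B.swap B M (C.duration M) f + fun q => dataReadout q f) := by
  cases f with
  | prepData q =>
    rw [spread_prepData]
    convert isColumn_single B.swap _ q 1
    ext q'
    simp [dataReadout]
  | measData q =>
    rw [spread_measData]
    convert isColumn_single B.swap _ q 1
    ext q'
    simp [dataReadout, Pi.single_apply, eq_comm]
  | prepAnc r c =>
    rw [spread_prepAnc]
    convert isColumn_zero B.swap _
    ext q'
    simp [dataReadout]
  | measAnc r c =>
    rw [spread_measAnc]
    convert isColumn_zero B.swap _
    ext q'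
    simp [dataReadout]
  | idle t v P =>
    rw [spread_idle _ _ _ _ _ hf.1]
    have h0 : (fun q => dataReadout q (.idle t v P)) = (0 : Fin n → ZMod 2) := rfl
    rw [h0, add_zero]
    cases v with
    | inl q =>
      rw [effective_single_inl]
      exact isColumn_single _ _ _ _
    | inr c => exact C.isColumn_effective_inr _ _ _ _ _
  | cnot r c q P Q =>
    obtain ⟨hr, hq, -⟩ := hf
    have h0 : (fun q' => dataReadout q' (.cnot r c q P Q)) = (0 : Fin n → ZMod 2) := rfl
    rw [h0, add_zero]
    have hm := C.cnot_lt_meas c q hq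
    have hd := C.start_meas_lt_duration hr c
    -- Only in this case do both halves of the fault contribute. They merge into the tail starting
    -- at `q` itself, so one column still suffices.
    by_cases h : c.1 = B.swap ∧ P c.1 = 1 ∧ Q c.1 = 1
    · obtain ⟨hb, hP, hQ⟩ := h
      rw [← hb]
      convert C.isColumn_tail hq
      ext q'
      rw [spread_cnot_same _ _ _ hr hq hP hQ]
      refine ite_eq_left_iff.2 fun h => ?_
      rw [tail, if_neg]
      rintro ⟨h1, -⟩
      have := C.cnot_lt_meas c q' h1
      omega
    · rw [spread_cnot _ _ _ _ _ _ _ (by omega)]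
      rcases zmod_two_eq (Q B.swap) with hQ | hQ
      · rw [hQ, Pi.single_zero, add_zero]
        exact C.isColumn_effective_inr _ _ _ _ _
      · convert isColumn_single B.swap _ q 1
        rw [hQ, add_eq_right]
        ext q'
        rw [effective_single_inr]
        refine ite_eq_right_iff.2 fun ⟨hb, _⟩ => ?_
        rw [← hb] at hQ ⊢
        exact (zmod_two_eq _).resolve_right fun hP => h ⟨hb, hP, hQ⟩

lemma dataFlip_eq_sum (B : PauliType) (M : ℕ) (e : Finset (Fault K)) :
    C.dataFlip B M e =
      ∑ f ∈ e, (C.spread B.swap B M (C.duration M) f + fun q => dataReadout q f) := by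
  ext q
  rw [dataFlip, frame_data_eq_sum_spread, Finset.sum_apply, ← Finset.sum_add_distrib]
  rfl

variable {C}

/-- The detectors of a type-`B` check telescope: its first outcome is unflipped, hence so is its
last, and the last detector reads the syndrome of the data flips. -/
lemma Undetected.mulVec_dataFlip {B : PauliType} {M : ℕ} {e : Finset (Fault K)}
    (h : C.Undetected B M e) : (K.H B).mulVec (C.dataFlip B M e) = 0 := by
  obtain ⟨h1, h2, h3⟩ := h
  ext i
  have key : ∀ r ≤ M - 1, C.ancFlip B M e r ⟨B, i⟩ = 0 := by
    intro r
    induction r with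
    | zero => exact fun _ => h2 i
    | succ r ih =>
      intro hr
      have := h1 ⟨B, i⟩ r (by omega)
      rwa [ih (by omega), zero_add] at this
  have := h3 i
  rwa [key _ le_rfl, zero_add] at this

variable (C)

theorem typeExtDistance_le_memoryDistance (L : LogicalBasis K) (B : PauliType) (M : ℕ) :
    typeExtDistance L B.swap (C.typeResidualErrors B.swap) ≤ C.memoryDistance L B M := by
  refine le_iInf₂ fun e ⟨hf, hu, hl⟩ => ?_
  choose! x hx1 hx2 using fun f (hfe : f ∈ e) => C.isColumn_fault B (hf f hfe)
  have hs : collapse (C.typeResidualErrors B.swap) (∑ f ∈ e, x f) - C.dataFlip B M e ∈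
      K.stab B.swap := by
    rw [map_sum, dataFlip_eq_sum, ← Finset.sum_sub_distrib]
    exact Submodule.sum_mem _ hx2
  have hH := K.mulVec_eq_zero_of_mem_stab hs
  have hL := L.mulVec_eq_zero_of_mem_stab hs
  rw [Matrix.mulVec_sub, sub_eq_zero] at hH hL
  refine (iInf₂_le (∑ f ∈ e, x f) ⟨?_, ?_⟩).trans (Nat.cast_le.2 (hammingNorm_sum_le e x hx1))
  · rw [extend_mulVec, hH, PauliType.swap_swap]
    exact hu.mulVec_dataFlip
  · rw [extend_mulVec, hL, PauliType.swap_swap]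
    exact hl

/-! ### Upper bound: realising columns by faults -/

/-- CNOTs propagate the `X` and `Z` components independently, so a component that is never inserted
never appears. -/
lemma frame_component_eq_zero (b B : PauliType) (M : ℕ) {e : Finset (Fault K)}
    (hinit : ∀ f ∈ e, ∀ v, injectInit B f v b = 0)
    (hinj : ∀ f ∈ e, ∀ t v, C.inject t f v b = 0) (t : ℕ) (v : K.Qubit) :
    C.frame B M e t v b = 0 := by
  induction t generalizing v with
  | zero =>
    simp only [frame, Finset.sum_apply]
    exact Finset.sum_eq_zero fun f hf => hinit f hf v
  | succ t ih =>
    have h : (∑ f ∈ e, C.inject t f) v b = 0 := by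
      simp only [Finset.sum_apply]
      exact Finset.sum_eq_zero fun f hf => hinj f hf t v
    rw [frame, Pi.add_apply, Pi.add_apply, h, add_zero]
    cases v with
    | inl q => simp [propagate, ih]
    | inr c =>
      rw [propagate]
      split_ifs <;> simp [ih]

/-- The error on the ancilla of a check at its measurement is the sum of the errors on the data qubits
at the CNOTs of the check. -/
lemma frame_ancilla_eq_sum (b B : PauliType) {M r : ℕ} {e : Finset (Fault K)} {c : K.Check}
    (hr : r < M) (hb : c.1 ≠ b) (hinj : ∀ f ∈ e, ∀ t, C.inject t f (.inr c) b = 0) :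
    C.frame B M e (C.start r + C.meas c) (.inr c) b =
      ∑ q ∈ K.supp c, C.frame B M e (C.start r + C.cnot c q) (.inl q) b := by
  have hi : ∀ t, (∑ f ∈ e, C.inject t f) (.inr c) b = 0 := by
    intro t
    simp only [Finset.sum_apply]
    exact Finset.sum_eq_zero fun f hf => hinj f hf t
  have key : ∀ t, C.start r + C.prep c + 1 ≤ t → t ≤ C.start r + C.meas c →
      C.frame B M e t (.inr c) b =
        ∑ q ∈ K.supp c, if C.start r + C.cnot c q < t then
          C.frame B M e (C.start r + C.cnot c q) (.inl q) b else 0 := by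
    intro t ht
    induction t, ht using Nat.le_induction with
    | base =>
      intro _
      rw [frame, Pi.add_apply, Pi.add_apply, hi, add_zero, propagate,
        if_pos ⟨r, by simpa using hr, rfl⟩]
      symm
      refine Finset.sum_eq_zero fun q hq => if_neg ?_
      have := C.prep_lt_cnot c q hq
      omega
    | succ t ht ih =>
      intro hm
      rw [frame, Pi.add_apply, Pi.add_apply, hi, add_zero, propagate,
        if_neg (C.not_prepAt_of_mem_round (r := r) (by omega) (by omega)), ih (by omega)]
      have hsum : (∑ q : Fin n, if C.CNOTAt M t c q ∧ c.1 ≠ b then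
          C.frame B M e t (.inl q) b else 0) =
          ∑ q ∈ K.supp c, if t = C.start r + C.cnot c q then
            C.frame B M e t (.inl q) b else 0 := by
        rw [← Finset.sum_subset (Finset.subset_univ (K.supp c))]
        · refine Finset.sum_congr rfl fun q hq => if_congr ?_ rfl rfl
          rw [C.cnotAt_iff_of_mem_round hr (by omega) (by omega)]
          simp [hq, hb]
        · intro q _ hq
          exact if_neg fun h => hq h.1.1
      rw [hsum, ← Finset.sum_add_distrib]
      refine Finset.sum_congr rfl fun q _ => ?_
      rcases lt_trichotomy (C.start r + C.cnot c q) t with h | h | h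
      · simp [h, h.ne', Nat.lt_succ_of_lt h]
      · simp [h]
      · have : ¬ C.start r + C.cnot c q < t + 1 := by omega
        simp [h.ne, h.not_gt, this]
  have hp := C.prep_lt_meas c
  rw [key _ (by omega) le_rfl]
  refine Finset.sum_congr rfl fun q hq => if_pos ?_
  have := C.cnot_lt_meas c q hq
  omega

/-- If faults `φ i` realise the columns of an extended matrix, and the checks of type `B` see either
all or none of their effects, then the memory distance is at most the weight of any vector of the
extended code that represents a logical error. -/
lemma memoryDistance_le_of_realization (L : LogicalBasis K) (B : PauliType) {M : ℕ} (hM : 1 ≤ M)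
    {R : Finset (K.Check × (Fin n → ZMod 2))} (φ : Fin n ⊕ R ↪ Fault K)
    (hfault : ∀ i, C.IsFault M (φ i))
    (hinit : ∀ i v, injectInit B (φ i) v B = 0)
    (hinj : ∀ i t v, C.inject t (φ i) v B = 0)
    (hanc : ∀ i t (c : K.Check), c.1 = B → C.inject t (φ i) (.inr c) B.swap = 0)
    (hread : ∀ i r c, ancReadout r c (φ i) = 0)
    (hcol : ∀ i, C.spread B.swap B M (C.duration M) (φ i) + (fun q => dataReadout q (φ i)) =
      collapse R (Pi.single i 1))
    (ε : ZMod 2)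
    (hmid : ∀ i, ∀ r < M, ∀ c : K.Check, c.1 = B → ∀ q ∈ K.supp c,
      C.spread B.swap B M (C.start r + C.cnot c q) (φ i) q =
        ε * collapse R (Pi.single i 1) q) :
    C.memoryDistance L B M ≤ typeExtDistance L B.swap R := by
  refine le_iInf₂ fun x ⟨hH, hL⟩ => ?_
  rw [extend_mulVec, PauliType.swap_swap] at hH hL
  set e := (Finset.univ.filter fun i => x i ≠ 0).map φ with he
  have hmem : ∀ f ∈ e, ∃ i, φ i = f := by
    intro f hf
    obtain ⟨i, -, rfl⟩ := Finset.mem_map.1 hf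
    exact ⟨i, rfl⟩
  have hflip : C.dataFlip B M e = collapse R x := by
    rw [dataFlip_eq_sum, sum_map_support, collapse_eq_sum]
    exact Finset.sum_congr rfl fun i _ => by rw [hcol]
  have hdata : ∀ r < M, ∀ c : K.Check, c.1 = B → ∀ q ∈ K.supp c,
      C.frame B M e (C.start r + C.cnot c q) (.inl q) B.swap = ε * collapse R x q := by
    intro r hr c hc q hq
    rw [frame_data_eq_sum_spread, sum_map_support, collapse_eq_sum, Finset.sum_apply,
      Finset.mul_sum]
    refine Finset.sum_congr rfl fun i _ => ?_
    rw [hmid i r hr c hc q hq]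
    simp only [Pi.smul_apply, smul_eq_mul]
    ring
  have hzero : ∀ r < M, ∀ c, C.ancFlip B M e r c = 0 := by
    intro r hr c
    have h0 : ∑ f ∈ e, ancReadout r c f = 0 :=
      Finset.sum_eq_zero fun f hf => by obtain ⟨i, rfl⟩ := hmem f hf; exact hread i r c
    rw [ancFlip, h0, add_zero]
    by_cases hc : c.1 = B
    · rw [hc, frame_ancilla_eq_sum _ _ _ hr (by rw [hc]; exact (PauliType.swap_ne B).symm)]
      -- The flip is `ε` times an entry of the syndrome of `collapse R x`, which is zero.
      · rw [Finset.sum_congr rfl (hdata r hr c hc), ← Finset.mul_sum]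
        subst hc
        have h1 := congrFun hH c.2
        have h2 : ∑ q ∈ K.supp c, collapse R x q = (K.H c.1).mulVec (collapse R x) c.2 := by
          rw [CSSCode.supp, Finset.sum_filter, Matrix.mulVec, dotProduct]
          refine Finset.sum_congr rfl fun q _ => ?_
          rcases zmod_two_eq (K.H c.1 c.2 q) with h | h <;> simp [h]
        rw [h2, h1, Pi.zero_apply, mul_zero]
      · intro f hf t
        obtain ⟨i, rfl⟩ := hmem f hf
        exact hanc i t c hc
    -- Checks of the other type read the component `B`, which no fault in `e` inserts.
    · have hs : c.1.swap = B := by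
        by_contra h
        exact hc (PauliType.ne_swap_iff.1 (Ne.symm h)).symm
      rw [hs]
      apply frame_component_eq_zero
      · intro f hf v
        obtain ⟨i, rfl⟩ := hmem f hf
        exact hinit i v
      · intro f hf t v
        obtain ⟨i, rfl⟩ := hmem f hf
        exact hinj i t v
  refine (iInf₂_le e ⟨?_, ⟨?_, ?_, ?_⟩, ?_⟩).trans ?_
  · rw [he, Finset.card_map]
    exact le_rfl
  · intro f hf
    obtain ⟨i, rfl⟩ := hmem f hf
    exact hfault i
  · intro c r hr
    rw [hzero r (by omega), hzero (r + 1) hr, add_zero]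
  · exact fun i => hzero 0 hM _
  · intro i
    rw [hzero (M - 1) (by omega), hflip, hH, Pi.zero_apply, add_zero]
  · rwa [hflip]

lemma exists_tail_of_mem_residualErrors {E : K.Check × (Fin n → ZMod 2)}
    (h : E ∈ C.residualErrors) : ∃ q ∈ K.supp E.1, C.tail E.1 q = E.2 := by
  obtain ⟨⟨c, q⟩, hp, rfl⟩ := Finset.mem_image.1 h
  exact ⟨q, (Finset.mem_filter.1 hp).2.1, rfl⟩

lemma NonInterleaved.cnot_lt_or_cnot_lt {C : SEC K} (h : C.NonInterleaved) (b : PauliType) :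
    (∀ c c' : K.Check, c.1 = b → c'.1 = b.swap → ∀ q ∈ K.supp c, q ∈ K.supp c' →
      C.cnot c q < C.cnot c' q) ∨
    (∀ c c' : K.Check, c.1 = b → c'.1 = b.swap → ∀ q ∈ K.supp c, q ∈ K.supp c' →
      C.cnot c' q < C.cnot c q) := by
  obtain ⟨a, h⟩ := h
  by_cases hab : a = b
  · subst hab
    left
    rintro ⟨_, i⟩ ⟨_, j⟩ rfl rfl q hq hq'
    exact h i j q (Finset.mem_inter.2 ⟨hq, hq'⟩)
  · have : b = a.swap := by
      by_contra h
      exact hab (PauliType.ne_swap_iff.1 h).symm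
    subst this
    right
    rw [PauliType.swap_swap]
    rintro ⟨_, i⟩ ⟨_, j⟩ rfl rfl q hq hq'
    exact h j i q (Finset.mem_inter.2 ⟨hq', hq⟩)

lemma inject_cnot_single_of_ne {b b' : PauliType} (hb : b' ≠ b) (t r : ℕ) (c : K.Check) (q : Fin n)
    (v : K.Qubit) : C.inject t (.cnot r c q (Pi.single b 1) (Pi.single b 1)) v b' = 0 := by
  rw [inject]
  split_ifs
  · simp only [Pi.add_apply]
    rw [Pi.single_apply, Pi.single_apply]
    split_ifs <;> simp [hb]
  · rfl

lemma inject_cnot_inr_of_ne {b : PauliType} (t r : ℕ) {c c' : K.Check} (hc : c ≠ c') (q : Fin n)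
    (P Q : Pauli) : C.inject t (.cnot r c q P Q) (.inr c') b = 0 := by
  rw [inject]
  split_ifs
  · have : (Sum.inr c' : K.Qubit) ≠ Sum.inr c := fun h => hc (Sum.inr.inj h).symm
    simp [Pi.single_eq_of_ne this]
  · rfl

/-- Residual errors realised in round `r₀` by CNOT faults, and data errors by the faults `d q`. -/
lemma memoryDistance_le_of_round (L : LogicalBasis K) (B : PauliType) {M r₀ : ℕ} (hr₀ : r₀ < M)
    (d : Fin n ↪ Fault K) (hd : ∀ q r c q' P Q, d q ≠ .cnot r c q' P Q)
    (hfault : ∀ q, C.IsFault M (d q))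
    (hinit : ∀ q v, injectInit B (d q) v B = 0)
    (hinj : ∀ q t, C.inject t (d q) = 0)
    (hread : ∀ q r c, ancReadout r c (d q) = 0)
    (hcol : ∀ q, C.spread B.swap B M (C.duration M) (d q) + (fun q' => dataReadout q' (d q)) =
      Pi.single q 1)
    (ε : ZMod 2)
    (hmid : ∀ q T, C.spread B.swap B M T (d q) = ε • Pi.single q 1)
    (horder : ∀ c c' : K.Check, c.1 = B.swap → c'.1 = B → ∀ q ∈ K.supp c, q ∈ K.supp c' →
      ∀ r < M, (if C.start r₀ + C.cnot c q < C.start r + C.cnot c' q then 1 else 0) = ε) :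
    C.memoryDistance L B M ≤ typeExtDistance L B.swap (C.typeResidualErrors B.swap) := by
  choose q hq hqE using fun E : C.typeResidualErrors B.swap =>
    C.exists_tail_of_mem_residualErrors (Finset.mem_filter.1 E.2).1
  have hE : ∀ E : C.typeResidualErrors B.swap, E.1.1.1 = B.swap := fun E =>
    (Finset.mem_filter.1 E.2).2
  have hne : B ≠ B.swap := (PauliType.swap_ne B).symm
  let φ : Fin n ⊕ C.typeResidualErrors B.swap → Fault K :=
    Sum.elim d fun E => .cnot r₀ E.1.1 (q E) (Pi.single B.swap 1) (Pi.single B.swap 1)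
  have hφ : Function.Injective φ := by
    rintro (i | E) (j | E') h
    · exact congrArg _ (d.injective h)
    · exact (hd _ _ _ _ _ _ h).elim
    · exact (hd _ _ _ _ _ _ h.symm).elim
    -- A residual error carries its check, so the check and the starting qubit of the tail determine
    -- it.
    · have h' : r₀ = r₀ ∧ E.1.1 = E'.1.1 ∧ q E = q E' ∧ _ ∧ _ := Fault.cnot.inj h
      have : E.1.2 = E'.1.2 := by rw [← hqE, ← hqE, h'.2.1, h'.2.2.1]
      exact congrArg _ (Subtype.ext (Prod.ext h'.2.1 this))
  have hspread : ∀ (E : C.typeResidualErrors B.swap) T q',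
      C.spread B.swap B M T (φ (.inr E)) q' =
        if C.start r₀ + C.cnot E.1.1 q' < T then E.1.2 q' else 0 := by
    intro E T q'
    have h := C.spread_cnot_same B T (P := Pi.single B.swap 1) (Q := Pi.single B.swap 1)
      hr₀ (hq E) (by rw [hE, Pi.single_eq_same]) (by rw [hE, Pi.single_eq_same]) q'
    rwa [hE, hqE] at h
  have hsupp : ∀ (E : C.typeResidualErrors B.swap) q', q' ∉ K.supp E.1.1 → E.1.2 q' = 0 := by
    intro E q' h
    rw [← hqE]
    exact if_neg fun h' => h h'.1
  refine C.memoryDistance_le_of_realization L B (by omega) ⟨φ, hφ⟩ ?_ ?_ ?_ ?_ ?_ ?_ ε ?_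
  · rintro (i | E)
    · exact hfault i
    · refine ⟨hr₀, hq E, fun h => ?_⟩
      have := congrFun (congrArg Prod.fst h) B.swap
      simp at this
  · rintro (i | E) v
    · exact hinit i v
    · rfl
  · rintro (i | E) t v
    · exact congrFun (congrFun (hinj i t) v) B
    · exact C.inject_cnot_single_of_ne hne _ _ _ _ _
  · rintro (i | E) t c hc
    · exact congrFun (congrFun (hinj i t) _) _
    · refine C.inject_cnot_inr_of_ne _ _ ?_ _ _ _
      rintro rfl
      exact hne (hc.symm.trans (hE E))
  · rintro (i | E) r c
    · exact hread i r c
    · rfl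
  · rintro (i | E)
    · rw [collapse_single_inl]
      exact hcol i
    · rw [collapse_single_inr]
      ext q'
      have h0 : dataReadout q' (φ (.inr E)) = 0 := rfl
      change C.spread _ _ _ _ (φ (.inr E)) q' + dataReadout q' (φ (.inr E)) = _
      rw [hspread, h0, add_zero]
      refine ite_eq_left_iff.2 fun h => (hsupp E q' fun h1 => h ?_).symm
      have := C.cnot_lt_meas _ _ h1
      have := C.start_meas_lt_duration hr₀ E.1.1
      omega
  · rintro (i | E) r hr c hc q' hq'
    · rw [collapse_single_inl]
      exact congrFun (hmid i _) q'
    · rw [collapse_single_inr]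
      change C.spread _ _ _ _ (φ (.inr E)) q' = _
      rw [hspread]
      by_cases h : q' ∈ K.supp E.1.1
      · rw [← horder E.1.1 c (hE E) hc q' h hq' r hr]
        simp
      · simp [hsupp E q' h]

theorem memoryDistance_le_typeExtDistance (hC : C.NonInterleaved) (L : LogicalBasis K)
    (B : PauliType) {M : ℕ} (hM : 1 ≤ M) :
    C.memoryDistance L B M ≤ typeExtDistance L B.swap (C.typeResidualErrors B.swap) := by
  rcases hC.cnot_lt_or_cnot_lt B.swap with h | h <;> rw [PauliType.swap_swap] at h
  · have hmid : ∀ q T, C.spread B.swap B M T (.prepData q) = Pi.single q 1 := by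
      intro q T
      rw [spread_prepData, Pi.single_eq_same]
    -- All errors reach each data qubit before its first CNOT with a type-`B` check, in round `0` or
    -- later: `ε = 1`.
    refine C.memoryDistance_le_of_round L B (r₀ := 0) hM ⟨.prepData, fun _ _ => Fault.prepData.inj⟩
      (by rintro _ _ _ _ _ _ ⟨⟩) (fun _ => trivial) ?_ (fun _ _ => rfl)
      (fun _ _ _ => rfl) ?_ 1 ?_ ?_
    · intro q v
      change (Pi.single (Sum.inl q) (Pi.single B.swap 1) : Frame K) v B = 0
      rw [Pi.single_apply]
      split_ifs
      · exact Pi.single_eq_of_ne (PauliType.swap_ne B).symm _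
      · rfl
    · intro q
      exact (congrArg (· + _) (hmid q _)).trans (add_zero _)
    · intro q T
      rw [one_smul]
      exact hmid q T
    · intro c c' hc hc' q hq hq' r _
      have h1 := h c c' hc hc' q hq hq'
      have h2 := C.start_mono_of_check c (Nat.zero_le r)
      exact if_pos (by omega)
  -- All errors reach each data qubit after its last CNOT with a type-`B` check: `ε = 0`.
  · refine C.memoryDistance_le_of_round L B (r₀ := M - 1) (by omega)
      ⟨.measData, fun _ _ => Fault.measData.inj⟩
      (by rintro _ _ _ _ _ _ ⟨⟩) (fun _ => trivial) (fun _ _ => rfl) (fun _ _ => rfl)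
      (fun _ _ _ => rfl) ?_ 0 ?_ ?_
    · intro q
      refine (congrArg (· + _) (C.spread_measData _ _ _ _ q)).trans ?_
      ext q'
      rw [Pi.add_apply, Pi.zero_apply, zero_add]
      change (if q = q' then (1 : ZMod 2) else 0) = _
      simp [Pi.single_apply, eq_comm]
    · intro q T
      rw [zero_smul]
      exact C.spread_measData _ _ _ _ q
    · intro c c' hc hc' q hq hq' r hr
      have h1 := h c c' hc hc' q hq hq'
      have h2 := C.start_mono_of_check c (Nat.le_sub_one_of_lt hr)
      exact if_neg (by omega)

/-! ### Comparison of the distances -/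

lemma extDistance_le_circuitDistance (L : LogicalBasis K) (M : ℕ) :
    extDistance L C.residualErrors ≤ C.circuitDistance L M := by
  -- The `X`-basis experiment corresponds to the `Z`-type extended distance and vice versa, hence
  -- the exchange.
  rw [extDistance, circuitDistance, min_comm]
  exact min_le_min (C.typeExtDistance_le_memoryDistance L .X M)
    (C.typeExtDistance_le_memoryDistance L .Z M)

lemma circuitDistance_eq_extDistance (hC : C.NonInterleaved) (L : LogicalBasis K) {M : ℕ}
    (hM : 1 ≤ M) : C.circuitDistance L M = extDistance L C.residualErrors := by
  refine le_antisymm ?_ (C.extDistance_le_circuitDistance L M)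
  rw [extDistance, circuitDistance, min_comm]
  exact min_le_min (C.memoryDistance_le_typeExtDistance hC L .Z hM)
    (C.memoryDistance_le_typeExtDistance hC L .X hM)

lemma SameOrder.residualErrors_eq {C C' : SEC K} (h : C.SameOrder C') :
    C'.residualErrors = C.residualErrors := by
  rw [residualErrors, residualErrors]
  have hf : ((Finset.univ : Finset (K.Check × Fin n)).filter fun p =>
        p.2 ∈ K.supp p.1 ∧ ∃ q ∈ K.supp p.1, C'.cnot p.1 q < C'.cnot p.1 p.2) =
      (Finset.univ : Finset (K.Check × Fin n)).filter fun p =>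
        p.2 ∈ K.supp p.1 ∧ ∃ q ∈ K.supp p.1, C.cnot p.1 q < C.cnot p.1 p.2 := by
    refine Finset.filter_congr fun p _ => and_congr_right fun hp => exists_congr fun q =>
      and_congr_right fun hq => (h p.1 q hq p.2 hp).symm
  rw [hf]
  refine Finset.image_congr fun p hp => Prod.ext rfl ?_
  have hp : p.2 ∈ K.supp p.1 := (Finset.mem_filter.1 hp).2.1
  ext q
  refine if_congr (and_congr_right fun hq => ?_) rfl rfl
  rw [← not_lt, ← not_lt, h p.1 q hq p.2 hp]

end SEC

/-- Every column for `R` is also a column for `R'`, so vectors transfer without gaining weight. -/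
lemma typeExtDistance_anti (L : LogicalBasis K) (b : PauliType)
    {R R' : Finset (K.Check × (Fin n → ZMod 2))} (h : R ⊆ R') :
    typeExtDistance L b R' ≤ typeExtDistance L b R := by
  refine le_iInf₂ fun x ⟨hH, hL⟩ => ?_
  choose! y hy1 hy2 using fun i : Fin n ⊕ R =>
    show ∃ y : Fin n ⊕ R' → ZMod 2, hammingNorm y ≤ 1 ∧
        collapse R' y = collapse R (Pi.single i 1) by
      rcases i with q | E
      · exact ⟨Pi.single (.inl q) 1, hammingNorm_single_le _ _, by
          rw [collapse_single_inl, collapse_single_inl]⟩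
      · exact ⟨Pi.single (.inr ⟨E.1, h E.2⟩) 1, hammingNorm_single_le _ _, by
          rw [collapse_single_inr, collapse_single_inr]⟩
  have hc : collapse R' (∑ i with x i ≠ 0, y i) = collapse R x := by
    rw [map_sum, collapse_eq_sum R x, Finset.sum_filter]
    refine Finset.sum_congr rfl fun i _ => ?_
    rcases zmod_two_eq (x i) with hx | hx <;> simp [hx, hy2]
  rw [extend_mulVec] at hH hL
  refine (iInf₂_le (∑ i with x i ≠ 0, y i) ⟨?_, ?_⟩).trans
    (Nat.cast_le.2 (hammingNorm_sum_le _ y fun i _ => hy1 i))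
  · rwa [extend_mulVec, hc]
  · rwa [extend_mulVec, hc]

lemma extDistance_anti (L : LogicalBasis K) {R R' : Finset (K.Check × (Fin n → ZMod 2))}
    (h : R ⊆ R') : extDistance L R' ≤ extDistance L R :=
  min_le_min (typeExtDistance_anti L _ (Finset.filter_subset_filter _ h))
    (typeExtDistance_anti L _ (Finset.filter_subset_filter _ h))

lemma extDistance_le_typeExtDistance (L : LogicalBasis K)
    (R : Finset (K.Check × (Fin n → ZMod 2))) (b : PauliType) :
    extDistance L R ≤ typeExtDistance L b (R.filter fun E => E.1.1 = b) := by
  cases b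
  · exact min_le_left _ _
  · exact min_le_right _ _

lemma extDistance_le_residualDistance (L : LogicalBasis K)
    {R : Finset (K.Check × (Fin n → ZMod 2))} {E : K.Check × (Fin n → ZMod 2)} (hE : E ∈ R) :
    extDistance L R ≤ residualDistance K E := by
  refine (extDistance_le_typeExtDistance L R E.1.1).trans ?_
  have hmem : E ∈ R.filter fun E' => E'.1.1 = E.1.1 := by simp [hE]
  generalize R.filter (fun E' => E'.1.1 = E.1.1) = S at hmem
  rw [residualDistance, ENat.add_iInf₂]
  refine le_iInf₂ fun D ⟨hD, hD'⟩ => ?_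
  -- One use of the column `E` plus the data columns in `D`: this accounts for the `1 +` in the
  -- residual distance.
  set x : Fin n ⊕ S → ZMod 2 := Pi.single (.inr ⟨E, hmem⟩) 1 + Sum.elim D 0 with hx
  have hc : collapse S x = E.2 + D := by
    rw [hx, map_add, collapse_single_inr]
    congr 1
    ext q
    simp [collapse_apply]
  have hH : (K.H E.1.1.swap).mulVec (E.2 + D) = 0 := hD
  refine (iInf₂_le x ⟨?_, ?_⟩).trans ?_
  · have h1 := hammingNorm_add_le (Pi.single (.inr ⟨E, hmem⟩) 1 : Fin n ⊕ S → ZMod 2)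
      (Sum.elim D 0)
    have h2 := hammingNorm_single_le (ι := Fin n ⊕ S) (.inr ⟨E, hmem⟩) 1
    have h3 : hammingNorm (Sum.elim D 0 : Fin n ⊕ S → ZMod 2) = hammingNorm D := by
      rw [hammingNorm, hammingNorm, Finset.card_filter, Finset.card_filter, Fintype.sum_sum_type]
      simp only [Sum.elim_inl, Sum.elim_inr, Pi.zero_apply, ne_eq, not_true_eq_false, if_false,
        Finset.sum_const_zero, add_zero]
      exact Finset.sum_congr rfl fun q _ => if_congr Iff.rfl rfl rfl
    rw [← hx, h3] at h1
    exact_mod_cast (by omega : hammingNorm x ≤ 1 + hammingNorm D)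
  · rw [extend_mulVec, hc, hH]
  · rw [extend_mulVec, hc]
    exact fun hL => hD' (L.mem_stab_of_mulVec_eq_zero hH hL)

end CSSCircuit

theorem theorem1 {n : ℕ} (K : CSSCircuit.CSSCode n) (L : CSSCircuit.LogicalBasis K)
    (C C' : CSSCircuit.SEC K) (hC' : C'.NonInterleaved) (hord : C.SameOrder C')
    (M M' : ℕ) (hM : 1 ≤ M) (hM' : 1 ≤ M') :
    C'.residualErrors = C.residualErrors ∧
    (∀ E ∈ C.residualErrors, C'.circuitDistance L M' ≤ CSSCircuit.residualDistance K E) ∧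
    (∀ R ⊆ C.residualErrors, C'.circuitDistance L M' ≤ CSSCircuit.extDistance L R) ∧
    C'.circuitDistance L M' = CSSCircuit.extDistance L C.residualErrors ∧
    C'.circuitDistance L M' ≤ C.circuitDistance L M := by
  have hR := hord.residualErrors_eq
  have hd := C'.circuitDistance_eq_extDistance hC' L hM'
  rw [hR] at hd
  refine ⟨hR, fun E hE => ?_, fun R hRs => ?_, hd, ?_⟩ <;> rw [hd]
  · exact CSSCircuit.extDistance_le_residualDistance L hE
  · exact CSSCircuit.extDistance_anti L hRs
  · exact C.extDistance_le_circuitDistance L M
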